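/- Words are over the alphabets $\Sigma_k=\{0,\dots,k-1\}$. Let $b_3$ be the Hall–Thue word, that is, the unique infinite word over $\Sigma_3$ that starts with $0$ and is fixed by the morphism $0\mapsto 012,\ 1\mapsto 02,\ 2\mapsto 1$. Let $g_5:\Sigma_3^*\to\Sigma_2^*$ be the morphism defined by $$g_5(0)=0000100000111000011000111,\qquad g_5(1)=000010000011000111,\qquad g_5(2)=0000011,$$ and let $g_5(b_3)$ be the image of $b_3$, a one-sided infinite binary word. A square is a word $uu$ with $u$ non-empty, and the factor set of an infinite word is the set of all its finite factors. Call an infinite or bi-infinite binary word good if each of its factors that is a square is one of $$00,\quad 11,\quad 0000,\quad 0001100011,\quad 1000010000 .$$ **Theorem (Five squares).** The word $g_5(b_3)$ is good, and every good bi-infinite binary word has the same factor set as $g_5(b_3)$. -/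

import Mathlib

namespace FewSquares

variable {α β : Type*}

/-- The image of a finite word under the morphism of free monoids that sends each letter `c`
to `h c`. -/
def applyMorphism (h : α → List β) (u : List α) : List β := u.flatMap h

/-- The prefix of length `n` of a one-sided infinite word. -/
def wordPrefix (w : ℕ → α) (n : ℕ) : List α := (List.range n).map w

/-- The infinite word `f^ω(a)`: its letter number `n` is the letter number `n` of `f^n(a)`.
It is meant for non-erasing `f` with `f a = a v`, `v` nonempty; `f^n(a)` then has more than `n`
letters and is a prefix of `f^(n+1)(a)`, so the default value of `getD` is not used. -/
def fixedPoint (f : α → List α) (a : α) : ℕ → α :=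
  fun n => ((applyMorphism f)^[n] [a]).getD n a

/-- The image `h(w)` of the infinite word `w` under a non-erasing morphism `h`: its letter number
`n` is the letter number `n` of the image of the prefix of length `n + 1` of `w`, which has at
least `n + 1` letters. -/
def imageWord [Inhabited β] (h : α → List β) (w : ℕ → α) : ℕ → β :=
  fun n => (applyMorphism h (wordPrefix w (n + 1))).getD n default

/-- The set of finite factors (blocks of consecutive letters, including the empty word) of an
infinite word, which is indexed by `ℕ` (one-sided) or by `ℤ` (bi-infinite). -/
def factorSet {ι : Type*} [AddMonoidWithOne ι] (w : ι → α) : Set (List α) :=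
  {u | ∃ (i : ι) (n : ℕ), u = (List.range n).map fun j : ℕ => w (i + (j : ι))}

/-- Every square `uu` (with `u` nonempty) that is a factor of `w` belongs to `S`. -/
def ContainsOnlySquares {ι : Type*} [AddMonoidWithOne ι] (w : ι → α) (S : Set (List α)) : Prop :=
  ∀ u : List α, u ≠ [] → u ++ u ∈ factorSet w → u ++ u ∈ S

/-- The morphism `0 ↦ 012`, `1 ↦ 02`, `2 ↦ 1`. -/
def hallThueMorphism : Fin 3 → List (Fin 3) :=
  ![[0, 1, 2], [0, 2], [1]]

/-- The Hall-Thue word `b₃`. -/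
def b3 : ℕ → Fin 3 := fixedPoint hallThueMorphism 0

/-- The morphism `g₅`. -/
def g5 : Fin 3 → List (Fin 2) :=
  ![[0,0,0,0,1,0,0,0,0,0,1,1,1,0,0,0,0,1,1,0,0,0,1,1,1],
    [0,0,0,0,1,0,0,0,0,0,1,1,0,0,0,1,1,1],
    [0,0,0,0,0,1,1]]

/-- The squares `00`, `11`, `0000`, `0001100011`, `1000010000`. -/
def fiveSquares : Set (List (Fin 2)) :=
  {[0,0], [1,1], [0,0,0,0], [0,0,0,1,1,0,0,0,1,1], [1,0,0,0,0,1,0,0,0,0]}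

theorem wordPrefix_prefix (w : ℕ → α) {m n : ℕ} (h : m ≤ n) :
    wordPrefix w m <+: wordPrefix w n := by
  obtain ⟨k, rfl⟩ := Nat.exists_eq_add_of_le h
  simp [wordPrefix, List.range_add]

theorem applyMorphism_prefix (h : α → List β) {u v : List α} (huv : u <+: v) :
    applyMorphism h u <+: applyMorphism h v := by
  obtain ⟨t, rfl⟩ := huv
  simp [applyMorphism]

theorem length_le_applyMorphism {h : α → List β} (hh : ∀ c, h c ≠ []) (u : List α) :
    u.length ≤ (applyMorphism h u).length := by
  induction u with
  | nil => simp
  | cons c u ih =>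
    have := List.length_pos_of_ne_nil (hh c)
    simp only [applyMorphism, List.flatMap_cons, List.length_append, List.length_cons] at ih ⊢
    omega

theorem getD_of_prefix {u v : List α} (huv : u <+: v) {n : ℕ} (hn : n < u.length) (d e : α) :
    u.getD n d = v.getD n e := by
  obtain ⟨t, rfl⟩ := huv
  rw [List.getD_append _ _ _ _ hn, List.getD_eq_getElem _ _ hn, List.getD_eq_getElem _ _ hn]

/-- The image under `h` of every prefix of `w` is a prefix of `imageWord h w`. -/
theorem wordPrefix_imageWord [Inhabited β] {h : α → List β} (hh : ∀ c, h c ≠ []) (w : ℕ → α)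
    (n : ℕ) :
    wordPrefix (imageWord h w) (applyMorphism h (wordPrefix w n)).length =
      applyMorphism h (wordPrefix w n) := by
  apply List.ext_getElem
  · simp [wordPrefix]
  · intro i h1 h2
    have h3 : i < (applyMorphism h (wordPrefix w (i + 1))).length := by
      have := length_le_applyMorphism hh (wordPrefix w (i + 1))
      simp only [wordPrefix, List.length_map, List.length_range] at this ⊢
      omega
    have h4 : imageWord h w i = (applyMorphism h (wordPrefix w n)).getD i default := by
      unfold imageWord
      rcases le_total (i + 1) n with hle | hle
      · exact getD_of_prefix (applyMorphism_prefix h (wordPrefix_prefix w hle)) h3 _ _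
      · exact (getD_of_prefix (applyMorphism_prefix h (wordPrefix_prefix w hle)) h2 _ _).symm
    rw [List.getD_eq_getElem _ _ h2] at h4
    simpa [wordPrefix] using h4

theorem hallThueMorphism_ne_nil (c : Fin 3) : hallThueMorphism c ≠ [] := by
  fin_cases c <;> simp [hallThueMorphism]

theorem g5_ne_nil (c : Fin 3) : g5 c ≠ [] := by
  fin_cases c <;> simp [g5]

theorem hallThue_iterate_prefix (n : ℕ) :
    (applyMorphism hallThueMorphism)^[n] [0] <+: (applyMorphism hallThueMorphism)^[n + 1] [0] := by
  induction n with
  | zero => exact ⟨[1, 2], rfl⟩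
  | succ n ih =>
    rw [Function.iterate_succ_apply', Function.iterate_succ_apply']
    exact applyMorphism_prefix _ ih

theorem hallThue_iterate_prefix_le {m n : ℕ} (h : m ≤ n) :
    (applyMorphism hallThueMorphism)^[m] [0] <+: (applyMorphism hallThueMorphism)^[n] [0] := by
  induction n, h using Nat.le_induction with
  | base => exact List.prefix_refl _
  | succ n _ ih => exact ih.trans (hallThue_iterate_prefix n)

theorem hallThue_iterate_length (n : ℕ) :
    n < ((applyMorphism hallThueMorphism)^[n] [0]).length := by
  have key : ∀ n, ∃ t, (applyMorphism hallThueMorphism)^[n] [0] = 0 :: t ∧ n ≤ t.length := by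
    intro n
    induction n with
    | zero => exact ⟨[], rfl, le_rfl⟩
    | succ n ih =>
      obtain ⟨t, ht, hn⟩ := ih
      refine ⟨1 :: 2 :: applyMorphism hallThueMorphism t, ?_, ?_⟩
      · rw [Function.iterate_succ_apply', ht]; rfl
      · have := length_le_applyMorphism hallThueMorphism_ne_nil t
        simp only [List.length_cons]
        omega
  obtain ⟨t, ht, hn⟩ := key n
  rw [ht, List.length_cons]
  omega

theorem wordPrefix_b3 (k : ℕ) :
    wordPrefix b3 ((applyMorphism hallThueMorphism)^[k] [0]).length =
      (applyMorphism hallThueMorphism)^[k] [0] := by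
  apply List.ext_getElem
  · simp [wordPrefix]
  · intro i h1 h2
    have h4 : b3 i = ((applyMorphism hallThueMorphism)^[k] [0]).getD i 0 := by
      unfold b3 fixedPoint
      rcases le_total i k with hle | hle
      · exact getD_of_prefix (hallThue_iterate_prefix_le hle) (hallThue_iterate_length i) _ _
      · exact (getD_of_prefix (hallThue_iterate_prefix_le hle) h2 _ _).symm
    rw [List.getD_eq_getElem _ _ h2] at h4
    simpa [wordPrefix] using h4

/-- `b₃` starts with `0`. -/
theorem b3_zero : b3 0 = 0 := rfl

/-- `b₃` is a fixed point of its morphism. -/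
theorem imageWord_b3 : imageWord hallThueMorphism b3 = b3 := by
  funext n
  have hp := wordPrefix_imageWord hallThueMorphism_ne_nil b3
    ((applyMorphism hallThueMorphism)^[n] [0]).length
  rw [wordPrefix_b3, ← Function.iterate_succ_apply' (applyMorphism hallThueMorphism)] at hp
  have hlen : n < ((applyMorphism hallThueMorphism)^[n + 1] [0]).length :=
    (Nat.lt_succ_self n).trans (hallThue_iterate_length (n + 1))
  have h2 := hp.trans (wordPrefix_b3 (n + 1)).symm
  have h3 := congrArg (fun l => l[n]?) h2
  simp only [wordPrefix, List.getElem?_map, List.getElem?_range hlen, Option.map_some,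
    Option.some.injEq] at h3
  exact h3

end FewSquares

/-!
Squares of an image word `f(v)` are compared with squares of `v`. For both morphisms `g5` and the
Hall–Thue morphism, block boundaries can be recognized from the next few letters, so a square of
large period in `f(v)` has block boundaries at the same places in both of its halves. The blocks
strictly inside the halves agree, since `f` is a prefix and suffix code, and there remain three
partly covered letters `a`, `b`, `c` in a factor `a u b u c` of `v`. Either `a = b` or `b = c`,
which gives a square in `v`, or `f b` splits into a prefix of `f c` and a suffix of `f a`, which
happens only for `0 u 1 u 0`; a square-free word with such a factor contains `010` or `212`. This is
`IsSynchronizing.exists_squareAt`. Applied to `b3 = f(b3)` it shows, by descent on the end of the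
square, that `b3` is square-free and avoids `010` and `212` (`isHallThue_b3`); applied to `g5` it
shows that `g5(b3)` is good, the squares of small period being checked by a finite search
(`containsOnlySquares_imageWord_g5`).

Conversely, a finite search shows that a good bi-infinite word has a block boundary, and that every
block boundary is followed and preceded by a block of `g5`. Hence it is `g5(v)` for a bi-infinite
word `v`, up to a shift, and `v` is again square-free and avoids `010` and `212`
(`exists_isImage_g5`). Such a word is the image of another such word under the Hall–Thue morphism
(`IsHallThue.exists_isImage`), so it can be desubstituted arbitrarily often: `w = F(v)` where
`F = g5 ∘ f^N` has long blocks. As `g5(b3) = F(b3)` too, the factor sets agree: short factors of `w`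
lie in some `F(ab)` with `a ≠ b`, and all six such words `ab` are factors of `b3`; factors of
`g5(b3)` near its beginning lie in `F(0)`, and `0` occurs in every such `v` (`factorSet_eq`).

The finite searches are evaluated in the kernel; `exists_of_search` is their correctness.
-/

namespace FewSquares

/-! ### Reading finite words inside an infinite word -/

section Reads

variable {ι α β γ : Type*} [AddMonoidWithOne ι]

/-- The finite word `u` occurs in `w` at position `i`. -/
def Reads (w : ι → α) : ι → List α → Prop
  | _, [] => True
  | i, c :: u => w i = c ∧ Reads w (i + 1) u

theorem reads_append {w : ι → α} {i : ι} {u t : List α} :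
    Reads w i (u ++ t) ↔ Reads w i u ∧ Reads w (i + (u.length : ι)) t := by
  induction u generalizing i with
  | nil => simp [Reads]
  | cons c u ih =>
    have h : i + 1 + (u.length : ι) = i + ((c :: u).length : ι) := by
      rw [List.length_cons, add_comm u.length 1, Nat.cast_add, Nat.cast_one, add_assoc]
    rw [List.cons_append, Reads, Reads, ih, h, and_assoc]

theorem reads_iff_getElem {w : ι → α} {i : ι} {u : List α} :
    Reads w i u ↔ ∀ (k : ℕ) (hk : k < u.length), w (i + (k : ι)) = u[k] := by
  induction u generalizing i with
  | nil => simp [Reads]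
  | cons c u ih =>
    have hs : ∀ k : ℕ, i + 1 + (k : ι) = i + ((k + 1 : ℕ) : ι) := by
      intro k
      rw [add_comm k 1, Nat.cast_add, Nat.cast_one, add_assoc]
    rw [Reads, ih]
    constructor
    · rintro ⟨h0, h1⟩ k hk
      cases k with
      | zero => simpa using h0
      | succ k =>
        rw [← hs]
        exact h1 k (by simpa using hk)
    · intro h
      have h0 := h 0 (by simp)
      rw [Nat.cast_zero, add_zero] at h0
      refine ⟨h0, fun k hk => ?_⟩
      rw [hs]
      exact h (k + 1) (by simpa using hk)

theorem mem_factorSet {w : ι → α} {u : List α} : u ∈ factorSet w ↔ ∃ i, Reads w i u := by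
  simp only [reads_iff_getElem, factorSet, Set.mem_ofPred_eq]
  constructor
  · rintro ⟨i, n, rfl⟩
    exact ⟨i, by simp⟩
  · rintro ⟨i, h⟩
    refine ⟨i, u.length, List.ext_getElem (by simp) fun k h1 h2 => ?_⟩
    simp [h k h1]

theorem Reads.drop {w : ι → α} {i : ι} {u : List α} (h : Reads w i u) {k : ℕ}
    (hk : k ≤ u.length) : Reads w (i + (k : ι)) (u.drop k) := by
  rw [← List.take_append_drop k u, reads_append, List.length_take, min_eq_left hk] at h
  exact h.2

theorem Reads.take {w : ι → α} {i : ι} {u : List α} (h : Reads w i u) (k : ℕ) :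
    Reads w i (u.take k) := by
  rw [← List.take_append_drop k u, reads_append] at h
  exact h.1

theorem Reads.exists_of_infix {w : ι → α} {i : ι} {u t : List α} (h : Reads w i u)
    (ht : t <:+: u) : ∃ j, Reads w j t := by
  obtain ⟨a, b, rfl⟩ := ht
  rw [reads_append, reads_append] at h
  exact ⟨_, h.1.2⟩

/-- The block of `n` letters of `w` that starts at position `i`. -/
def window (w : ι → α) (i : ι) (n : ℕ) : List α := (List.range n).map fun j : ℕ => w (i + (j : ι))

@[simp] theorem length_window (w : ι → α) (i : ι) (n : ℕ) : (window w i n).length = n := by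
  simp [window]

theorem reads_window (w : ι → α) (i : ι) (n : ℕ) : Reads w i (window w i n) := by
  simp [reads_iff_getElem, window]

theorem window_eq_of_reads {w : ι → α} {i : ι} {u : List α} (h : Reads w i u) :
    window w i u.length = u := by
  rw [reads_iff_getElem] at h
  refine List.ext_getElem (by simp) fun k h1 h2 => ?_
  simp [window, h k h2]

theorem window_one_add (w : ι → α) (i : ι) (n : ℕ) :
    window w i (n + 1) = w i :: window w (i + 1) n := by
  have : Reads w i (w i :: window w (i + 1) n) := ⟨rfl, reads_window _ _ _⟩
  simpa using window_eq_of_reads this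

theorem Reads.prefix_of_le {w : ι → α} {i : ι} {u t : List α} (hu : Reads w i u)
    (ht : Reads w i t) (hle : u.length ≤ t.length) : u <+: t := by
  have := window_eq_of_reads (ht.take u.length)
  rw [List.length_take, min_eq_left hle, window_eq_of_reads hu] at this
  rw [this]
  exact List.take_prefix _ _

theorem Reads.suffix_of_le {w : ℕ → α} {i j : ℕ} {u t : List α} (hu : Reads w i u)
    (ht : Reads w j t) (hji : j ≤ i) (h : i + u.length = j + t.length) : u <:+ t := by
  have hd := ht.drop (k := i - j) (by omega)
  rw [Nat.cast_id, Nat.add_sub_of_le hji] at hd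
  have h1 := window_eq_of_reads hd
  have h2 : (t.drop (i - j)).length = u.length := by simp; omega
  rw [h2, window_eq_of_reads hu] at h1
  rw [h1]
  exact List.drop_suffix _ _

/-- A square of period `p` occurs in `w` at position `i`. -/
def SquareAt (w : ι → α) (i : ι) (p : ℕ) : Prop :=
  ∀ k : ℕ, k < p → w (i + (k : ι)) = w (i + (p : ι) + (k : ι))

theorem squareAt_of_reads {w : ι → α} {i : ι} {u : List α} (h : Reads w i (u ++ u)) :
    SquareAt w i u.length := by
  rw [reads_append, reads_iff_getElem, reads_iff_getElem] at h
  intro k hk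
  rw [h.1 k hk, h.2 k hk]

theorem SquareAt.reads {w : ι → α} {i : ι} {p : ℕ} (h : SquareAt w i p) :
    Reads w i (window w i p ++ window w i p) := by
  rw [reads_append, length_window]
  refine ⟨reads_window _ _ _, ?_⟩
  rw [reads_iff_getElem]
  intro k hk
  rw [length_window] at hk
  rw [← h k hk]
  simp [window]

theorem ContainsOnlySquares.mem_of_squareAt {w : ι → α} {s : Set (List α)}
    (hw : ContainsOnlySquares w s) {i : ι} {p : ℕ} (hp : 0 < p) (h : SquareAt w i p) :
    window w i p ++ window w i p ∈ s := by
  refine hw _ (fun h0 => ?_) (mem_factorSet.2 ⟨i, h.reads⟩)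
  have := length_window w i p
  rw [h0] at this
  simp at this
  omega

/-! ### Images of infinite words under a morphism -/

/-- The word `w` is the concatenation of the blocks `f (v n)`, the block number `n` starting at
position `S n`. For words indexed by `ℤ` this leaves the choice of the origin free. -/
def IsImage (f : γ → List β) (v : ι → γ) (w : ι → β) (S : ι → ι) : Prop :=
  ∀ n, Reads w (S n) (f (v n)) ∧ S (n + 1) = S n + ((f (v n)).length : ι)

theorem IsImage.reads {f : γ → List β} {v : ι → γ} {w : ι → β} {S : ι → ι}
    (h : IsImage f v w S) {n : ι} {u : List γ} (hu : Reads v n u) :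
    Reads w (S n) (applyMorphism f u) ∧
      S (n + (u.length : ι)) = S n + ((applyMorphism f u).length : ι) := by
  induction u generalizing n with
  | nil => simp [Reads, applyMorphism]
  | cons c u ih =>
    obtain ⟨rfl, hu⟩ := hu
    obtain ⟨h1, h2⟩ := ih hu
    obtain ⟨h3, h4⟩ := h n
    have e : n + ((v n :: u).length : ι) = n + 1 + (u.length : ι) := by
      rw [List.length_cons, add_comm u.length 1, Nat.cast_add, Nat.cast_one, add_assoc]
    rw [e, h2, h4]
    rw [h4] at h1
    simp only [applyMorphism, List.flatMap_cons, List.length_append, Nat.cast_add] at *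
    exact ⟨reads_append.2 ⟨h3, h1⟩, add_assoc _ _ _⟩

theorem IsImage.comp {f : γ → List β} {g : α → List γ} {u : ι → α} {v : ι → γ} {w : ι → β}
    {S T : ι → ι} (hf : IsImage f v w S) (hg : IsImage g u v T) :
    IsImage (fun c => applyMorphism f (g c)) u w (S ∘ T) := by
  intro n
  obtain ⟨h1, h2⟩ := hg n
  obtain ⟨h3, h4⟩ := hf.reads h1
  exact ⟨h3, by rw [Function.comp_apply, h2, h4]; rfl⟩

end Reads

section Images

variable {β γ : Type*}

theorem applyMorphism_ne_nil {f : γ → List β} (hf : ∀ c, f c ≠ []) {u : List γ} (hu : u ≠ []) :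
    applyMorphism f u ≠ [] := by
  rw [← List.length_pos_iff] at hu ⊢
  exact hu.trans_le (length_le_applyMorphism hf u)

theorem reads_zero_wordPrefix {α : Type*} (w : ℕ → α) (n : ℕ) : Reads w 0 (wordPrefix w n) := by
  simp [reads_iff_getElem, wordPrefix]

theorem isImage_imageWord [Inhabited β] {h : γ → List β} (hh : ∀ c, h c ≠ []) (v : ℕ → γ) :
    IsImage h v (imageWord h v) fun n => (applyMorphism h (wordPrefix v n)).length := by
  intro n
  have h1 := reads_zero_wordPrefix (imageWord h v) (applyMorphism h (wordPrefix v (n + 1))).length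
  rw [wordPrefix_imageWord hh] at h1
  have h2 : applyMorphism h (wordPrefix v (n + 1)) =
      applyMorphism h (wordPrefix v n) ++ h (v n) := by
    simp [applyMorphism, wordPrefix, List.range_succ]
  rw [h2, reads_append] at h1
  exact ⟨by simpa using h1.2, by simp only [h2, List.length_append, Nat.cast_id]⟩

/-- A bi-infinite word with a set `B` of cutting points, such that every cutting point is followed
and preceded by a block `f c` that leads to another cutting point, is an image under `f`. -/
theorem exists_isImage {f : γ → List β} {w : ℤ → β} {B : ℤ → Prop} (hB : ∃ i, B i)
    (hr : ∀ i, B i → ∃ c, Reads w i (f c) ∧ B (i + (f c).length))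
    (hl : ∀ i, B i → ∃ c, Reads w (i - (f c).length) (f c) ∧ B (i - (f c).length)) :
    ∃ v S, IsImage f v w S := by
  obtain ⟨i₀, h₀⟩ := hB
  have hr' : ∀ i : {i // B i}, ∃ (c : γ) (i' : {i // B i}),
      Reads w i.1 (f c) ∧ i'.1 = i.1 + (f c).length := by
    rintro ⟨i, hi⟩
    obtain ⟨c, h1, h2⟩ := hr i hi
    exact ⟨c, ⟨_, h2⟩, h1, rfl⟩
  have hl' : ∀ i : {i // B i}, ∃ (c : γ) (i' : {i // B i}),
      Reads w i'.1 (f c) ∧ i.1 = i'.1 + (f c).length := by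
    rintro ⟨i, hi⟩
    obtain ⟨c, h1, h2⟩ := hl i hi
    exact ⟨c, ⟨_, h2⟩, h1, by simp⟩
  choose cr nr hr1 hr2 using hr'
  choose cl nl hl1 hl2 using hl'
  let i₀' : {i // B i} := ⟨i₀, h₀⟩
  let v : ℤ → γ := fun n => match n with
    | Int.ofNat n => cr (nr^[n] i₀')
    | Int.negSucc n => cl (nl^[n] i₀')
  let S : ℤ → ℤ := fun n => match n with
    | Int.ofNat n => (nr^[n] i₀').1
    | Int.negSucc n => (nl^[n + 1] i₀').1
  refine ⟨v, S, fun n => ?_⟩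
  match n with
  | Int.ofNat n =>
    refine ⟨hr1 _, ?_⟩
    change (nr^[n + 1] i₀').1 = _
    rw [Function.iterate_succ_apply', hr2]
  | Int.negSucc n =>
    have e : S (Int.negSucc n + 1) = (nl^[n] i₀').1 := by
      cases n with
      | zero => rfl
      | succ n => rfl
    rw [e]
    change Reads w (nl^[n + 1] i₀').1 (f (cl (nl^[n] i₀'))) ∧
      _ = (nl^[n + 1] i₀').1 + ((f (cl (nl^[n] i₀'))).length : ℤ)
    rw [Function.iterate_succ_apply']
    exact ⟨hl1 _, hl2 _⟩

end Images

/-! ### Checking the squares of a finite word, and exhaustive search -/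

section Search

variable {α : Type*}

/-- Every square that is a prefix of `u` belongs to `allowed`. -/
def headSquaresIn [DecidableEq α] (allowed : List (List α)) (u : List α) : Bool :=
  (List.range (u.length / 2)).all fun k =>
    !(u.take (k + 1)).isPrefixOf (u.drop (k + 1)) || allowed.contains (u.take (2 * (k + 1)))

theorem headSquaresIn_of_forall [DecidableEq α] {allowed : List (List α)} {u : List α}
    (h : ∀ x : List α, x ≠ [] → x ++ x <:+: u → x ++ x ∈ allowed) :
    headSquaresIn allowed u = true := by
  simp only [headSquaresIn, List.all_eq_true, List.mem_range, Bool.or_eq_true,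
    Bool.not_eq_true', List.contains_iff_mem]
  intro k hk
  by_cases hp : (u.take (k + 1)).isPrefixOf (u.drop (k + 1)) = true
  · right
    rw [List.isPrefixOf_iff_prefix] at hp
    have hlen : (u.take (k + 1)).length = k + 1 := by simp; omega
    obtain ⟨t, ht⟩ := hp
    have hu : u = u.take (k + 1) ++ u.take (k + 1) ++ t := by
      rw [List.append_assoc, ht, List.take_append_drop]
    have e : u.take (2 * (k + 1)) = u.take (k + 1) ++ u.take (k + 1) := by
      conv_lhs => rw [hu]
      exact List.take_left' (by rw [List.length_append, hlen]; omega)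
    rw [e]
    refine h _ (fun h0 => ?_) ⟨[], t, by rw [List.nil_append, ← hu]⟩
    rw [h0] at hlen
    simp at hlen
  · exact Or.inl (Bool.eq_false_iff.2 hp)

theorem mem_of_headSquaresIn [DecidableEq α] {allowed : List (List α)} {u x : List α}
    (h : headSquaresIn allowed u = true) (hx : x ≠ []) (hxu : x ++ x <+: u) :
    x ++ x ∈ allowed := by
  simp only [headSquaresIn, List.all_eq_true, List.mem_range, Bool.or_eq_true,
    Bool.not_eq_true', List.contains_iff_mem] at h
  obtain ⟨t, rfl⟩ := hxu
  have hpos := List.length_pos_of_ne_nil hx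
  have h1 := h (x.length - 1) (by simp; omega)
  have e : x.length - 1 + 1 = x.length := by omega
  rw [e] at h1
  have e1 : (x ++ x ++ t).take x.length = x := by rw [List.append_assoc]; exact List.take_left' rfl
  have e2 : (x ++ x ++ t).drop x.length = x ++ t := by
    rw [List.append_assoc]; exact List.drop_left' rfl
  have e3 : (x ++ x ++ t).take (2 * x.length) = x ++ x := List.take_left' (by simp; omega)
  rw [e1, e2, e3] at h1
  rcases h1 with h1 | h1
  · have : x.isPrefixOf (x ++ t) = true := by simp
    rw [this] at h1
    cases h1
  · exact h1

/-- Depth-first search through the words obtained from `u` by adding letters on the left, one at a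
time. A branch ends when `accept` holds or `ok` fails; the result is `true` if every branch ends
after at most `n` steps. -/
def search (letters : List α) (ok accept : List α → Bool) : ℕ → List α → Bool
  | 0, u => accept u
  | n + 1, u => accept u || letters.all fun c => !ok (c :: u) || search letters ok accept n (c :: u)

theorem exists_of_search {letters : List α} {ok accept : List α → Bool} {P : List α → Prop}
    (hext : ∀ u, P u → ∃ c ∈ letters, P (c :: u)) (hok : ∀ u, P u → ok u = true) {n : ℕ}
    {u : List α} (h : search letters ok accept n u = true) (hu : P u) :
    ∃ t, P (t ++ u) ∧ accept (t ++ u) = true := by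
  induction n generalizing u with
  | zero => exact ⟨[], hu, h⟩
  | succ n ih =>
    rw [search, Bool.or_eq_true, List.all_eq_true] at h
    rcases h with h | h
    · exact ⟨[], hu, h⟩
    · obtain ⟨c, hc, hcu⟩ := hext u hu
      have h1 := h c hc
      rw [hok _ hcu, Bool.not_true, Bool.false_or] at h1
      obtain ⟨t, h2, h3⟩ := ih h1 hcu
      exact ⟨t ++ [c], by simpa using h2, by simpa using h3⟩

/-- Search to the left of an occurrence of `u` that ends at position `i`. -/
theorem exists_reads_of_search_left {letters : List α} {ok accept : List α → Bool} {w : ℤ → α}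
    (hletters : ∀ c, c ∈ letters) (hok : ∀ i u, Reads w i u → ok u = true) {n : ℕ} {u : List α}
    (h : search letters ok accept n u = true) {i : ℤ} (hu : Reads w (i - u.length) u) :
    ∃ t, Reads w (i - (t ++ u).length) (t ++ u) ∧ accept (t ++ u) = true := by
  refine exists_of_search (P := fun u => Reads w (i - u.length) u) (fun u hu => ?_)
    (fun u hu => hok _ _ hu) h hu
  refine ⟨w (i - u.length - 1), hletters _, ?_⟩
  have e : i - ((w (i - u.length - 1) :: u).length : ℤ) = i - u.length - 1 := by
    simp; ring
  rw [e]
  exact ⟨rfl, by simpa using hu⟩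

/-- Search to the right of an occurrence of `u` at position `i`; the search runs through the
reversed words. -/
theorem exists_reads_of_search_right {ι : Type*} [AddMonoidWithOne ι] {letters : List α}
    {ok accept : List α → Bool} {w : ι → α} (hletters : ∀ c, c ∈ letters)
    (hok : ∀ i u, Reads w i u → ok u.reverse = true) {n : ℕ} {u : List α}
    (h : search letters ok accept n u.reverse = true) {i : ι} (hu : Reads w i u) :
    ∃ t, Reads w i (u ++ t) ∧ accept (u ++ t).reverse = true := by
  obtain ⟨t, h1, h2⟩ := exists_of_search (P := fun u => Reads w i u.reverse) (fun u hu => by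
      refine ⟨w (i + (u.length : ι)), hletters _, ?_⟩
      rw [List.reverse_cons, reads_append, List.length_reverse]
      exact ⟨hu, rfl, trivial⟩)
    (fun u hu => by simpa using hok _ _ hu) h (by simpa using hu)
  exact ⟨t.reverse, by simpa using h1, by simpa using h2⟩

theorem ContainsOnlySquares.forall_of_reads {ι : Type*} [AddMonoidWithOne ι] {w : ι → α}
    {s : Set (List α)} (hw : ContainsOnlySquares w s) {i : ι} {u : List α} (hu : Reads w i u)
    (x : List α) (hx : x ≠ []) (hxu : x ++ x <:+: u) : x ++ x ∈ s :=
  hw x hx (mem_factorSet.2 (hu.exists_of_infix hxu))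

theorem headSquaresIn_of_reads {ι : Type*} [AddMonoidWithOne ι] [DecidableEq α] {w : ι → α}
    {allowed : List (List α)} (hw : ContainsOnlySquares w {x | x ∈ allowed}) {i : ι} {u : List α}
    (hu : Reads w i u) : headSquaresIn allowed u = true :=
  headSquaresIn_of_forall (hw.forall_of_reads hu)

theorem headSquaresIn_reverse_of_reads {ι : Type*} [AddMonoidWithOne ι] [DecidableEq α]
    {w : ι → α} {allowed : List (List α)} (hw : ContainsOnlySquares w {x | x ∈ allowed}) {i : ι}
    {u : List α} (hu : Reads w i u) :
    headSquaresIn (allowed.map List.reverse) u.reverse = true := by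
  refine headSquaresIn_of_forall fun x hx hxu => ?_
  have h1 : x.reverse ++ x.reverse <:+: u := by
    rw [← List.reverse_append, ← List.reverse_infix, List.reverse_reverse]
    exact hxu
  have h2 := hw.forall_of_reads hu x.reverse (by simpa using hx) h1
  exact List.mem_map.2 ⟨_, h2, by simp⟩

end Search

/-! ### Pulling long squares back through a synchronizing morphism -/

section Pullback

variable {β γ : Type*}

theorem SquareAt.reads_add_iff {x : ℕ → β} {a p i : ℕ} {u : List β} (h : SquareAt x a p)
    (h1 : a ≤ i) (h2 : i + u.length ≤ a + p) : Reads x (i + p) u ↔ Reads x i u := by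
  simp only [reads_iff_getElem]
  refine forall₂_congr fun k hk => ?_
  have := h (i + k - a) (by omega)
  have e1 : a + (i + k - a) = i + k := by omega
  have e2 : a + p + (i + k - a) = i + p + k := by omega
  simp only [Nat.cast_id, e1, e2] at this
  simp only [Nat.cast_id, this]

namespace IsImage

variable {f : γ → List β} {v : ℕ → γ} {x : ℕ → β} {S : ℕ → ℕ}

theorem add_length (h : IsImage f v x S) (n : ℕ) : S (n + 1) = S n + (f (v n)).length := (h n).2

theorem strictMono (h : IsImage f v x S) (hf : ∀ c, f c ≠ []) : StrictMono S :=
  strictMono_nat_of_lt_succ fun n => by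
    have := List.length_pos_of_ne_nil (hf (v n))
    have := h.add_length n
    omega

theorem exists_block (h : IsImage f v x S) (hf : ∀ c, f c ≠ []) (h0 : S 0 = 0) (i : ℕ) :
    ∃ m j, i = S m + j ∧ j < (f (v m)).length := by
  have hmono := h.strictMono hf
  have hex : ∃ m, i < S m := ⟨i + 1, hmono.le_apply⟩
  classical
  have h1 := Nat.find_spec hex
  have h2 : Nat.find hex ≠ 0 := fun h3 => by rw [h3, h0] at h1; omega
  obtain ⟨m, hm⟩ := Nat.exists_eq_succ_of_ne_zero h2
  have h3 := Nat.find_min hex (m := m) (by omega)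
  have h4 := h.add_length m
  rw [hm] at h1
  exact ⟨m, i - S m, by omega, by simp only [Nat.succ_eq_add_one] at h1; omega⟩

end IsImage

/-- The conditions on a morphism of the ternary alphabet under which long squares of an image word
come from squares of the preimage. The map is a prefix code and a suffix code. A block `f b` is
never a prefix of `f c` followed by a suffix of `f a`, unless this is forced by `a = b` or `c = b`,
or `a = c = 0` and `b = 1`. Block boundaries are recognized by the test `cut` on the next `L`
letters. -/
structure IsSynchronizing [DecidableEq β] (f : Fin 3 → List β) (L M : ℕ) (cut : List β → Bool) :
    Prop where
  pos : 0 < L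
  ne_nil : ∀ c, f c ≠ []
  length_le : ∀ c, (f c).length ≤ M
  prefix_code : ∀ a b, f a <+: f b → a = b
  suffix_code : ∀ a b, f a <:+ f b → a = b
  splits : ∀ a b c, ∀ r < (f b).length, (f b).take r <+: f c → (f b).drop r <:+ f a →
    a = b ∨ 0 < r ∧ (c = b ∨ a = 0 ∧ b = 1 ∧ c = 0)
  cut_iff : ∀ a b c, ∀ j < (f a).length, j + L ≤ (f a ++ (f b ++ f c)).length ∧
    cut (((f a ++ (f b ++ f c)).drop j).take L) = decide (j = 0)

theorem IsSynchronizing.exists_eq_iff [DecidableEq β] {f : Fin 3 → List β} {L M : ℕ}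
    {cut : List β → Bool} (hf : IsSynchronizing f L M cut) {v : ℕ → Fin 3} {x : ℕ → β} {S : ℕ → ℕ}
    (h : IsImage f v x S) (h0 : S 0 = 0) (i : ℕ) : (∃ m, S m = i) ↔ cut (window x i L) = true := by
  obtain ⟨m, j, rfl, hj⟩ := h.exists_block hf.ne_nil h0 i
  have h1 : Reads x (S m) (f (v m) ++ (f (v (m + 1)) ++ f (v (m + 2)))) := by
    have := (h.reads (n := m) (u := [v m, v (m + 1), v (m + 2)]) ⟨rfl, rfl, rfl, trivial⟩).1
    simpa [applyMorphism] using this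
  obtain ⟨h2, h3⟩ := hf.cut_iff (v m) (v (m + 1)) (v (m + 2)) j hj
  have h4 := (h1.drop (k := j) (by omega)).take L
  have h5 := window_eq_of_reads h4
  rw [List.length_take, List.length_drop, min_eq_left (by omega), Nat.cast_id] at h5
  rw [h5, h3, decide_eq_true_iff]
  have hmono := h.strictMono hf.ne_nil
  constructor
  · rintro ⟨n, hn⟩
    have h6 : m < n + 1 := hmono.lt_iff_lt.1 (by have := hmono n.lt_add_one; omega)
    have h7 : n < m + 1 := hmono.lt_iff_lt.1 (by have := h.add_length m; omega)
    have : n = m := by omega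
    subst this
    omega
  · rintro rfl
    exact ⟨m, rfl⟩

/-- A square of large period in the image of `v` under a synchronizing morphism comes from a square
of `v`, not further to the right, unless `v` contains `010` or `212`. -/
theorem IsSynchronizing.exists_squareAt [DecidableEq β] {f : Fin 3 → List β} {L M : ℕ}
    {cut : List β → Bool} (hf : IsSynchronizing f L M cut) {v : ℕ → Fin 3} {x : ℕ → β} {S : ℕ → ℕ}
    (h : IsImage f v x S) (h0 : S 0 = 0) (h010 : [0, 1, 0] ∉ factorSet v)
    (h212 : [2, 1, 2] ∉ factorSet v) {a p : ℕ} (hp : M + L ≤ p + 1) (hsq : SquareAt x a p) :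
    ∃ m q, 0 < q ∧ SquareAt v m q ∧ S (m + 2 * q - 1) < a + 2 * p := by
  have hLpos := hf.pos
  have hmono := h.strictMono hf.ne_nil
  have hadd := h.add_length
  have hMpos : 0 < M := (List.length_pos_of_ne_nil (hf.ne_nil 0)).trans_le (hf.length_le 0)
  have hblock : ∀ n, Reads x (S n) (f (v n)) := fun n => (h n).1
  -- `m₀` is the first block boundary inside the square
  obtain ⟨m₀, ham, hmin⟩ : ∃ m, a ≤ S m ∧ ∀ n < m, S n < a := by
    classical
    have hex : ∃ m, a ≤ S m := ⟨a, hmono.le_apply⟩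
    exact ⟨Nat.find hex, Nat.find_spec hex, fun n hn => not_le.1 (Nat.find_min hex hn)⟩
  have hlt : S m₀ < a + M := by
    rcases Nat.eq_zero_or_pos m₀ with h1 | h1
    · rw [h1, h0]; omega
    · have h2 := hmin (m₀ - 1) (by omega)
      have h3 := hadd (m₀ - 1)
      rw [Nat.sub_add_cancel h1] at h3
      have := hf.length_le (v (m₀ - 1))
      omega
  obtain ⟨n₀, hn₀⟩ : ∃ n, S n = S m₀ + p := by
    rw [hf.exists_eq_iff h h0]
    have h1 := (hf.exists_eq_iff h h0 (S m₀)).1 ⟨m₀, rfl⟩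
    have h2 : Reads x (S m₀ + p) (window x (S m₀) L) :=
      (hsq.reads_add_iff ham (by rw [length_window]; omega)).2 (reads_window _ _ _)
    have h3 := window_eq_of_reads h2
    rw [length_window] at h3
    rw [h3, h1]
  -- `k` is the number of blocks inside the first period
  obtain ⟨k, hk, hk'⟩ : ∃ k, S (m₀ + k) ≤ a + p ∧ a + p < S (m₀ + (k + 1)) := by
    classical
    have hex : ∃ k, a + p < S (m₀ + (k + 1)) :=
      ⟨a + p, lt_of_lt_of_le (by omega) (hmono.le_apply (x := m₀ + (a + p + 1)))⟩
    refine ⟨Nat.find hex, ?_, Nat.find_spec hex⟩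
    rcases Nat.eq_zero_or_pos (Nat.find hex) with h1 | h1
    · rw [h1]; simp only [add_zero]; omega
    · have h2 := Nat.find_min hex (m := Nat.find hex - 1) (by omega)
      rw [Nat.sub_add_cancel h1] at h2
      omega
  have hmatch : ∀ i ≤ k, S (n₀ + i) = S (m₀ + i) + p ∧ ∀ j < i, v (m₀ + j) = v (n₀ + j) := by
    intro i
    induction i with
    | zero => intro _; exact ⟨hn₀, by simp⟩
    | succ i ih =>
      intro hi
      obtain ⟨h1, h2⟩ := ih (by omega)
      have h3 : S (m₀ + i + 1) ≤ S (m₀ + k) := hmono.monotone (by omega)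
      have h4 : S m₀ ≤ S (m₀ + i) := hmono.monotone (by omega)
      have h5 := hadd (m₀ + i)
      have h6 := hadd (n₀ + i)
      have h7 : Reads x (S (n₀ + i)) (f (v (m₀ + i))) := by
        rw [h1]
        exact (hsq.reads_add_iff (by omega) (by omega)).2 (hblock _)
      have h8 : v (m₀ + i) = v (n₀ + i) := by
        rcases le_total (f (v (m₀ + i))).length (f (v (n₀ + i))).length with hle | hle
        · exact hf.prefix_code _ _ (h7.prefix_of_le (hblock _) hle)
        · exact (hf.prefix_code _ _ ((hblock _).prefix_of_le h7 hle)).symm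
      refine ⟨?_, fun j hj => ?_⟩
      · rw [← h8] at h6
        rw [← add_assoc, ← add_assoc, h6, h5, h1]
        omega
      · rcases Nat.lt_succ_iff_lt_or_eq.1 hj with hj | rfl
        · exact h2 j hj
        · exact h8
  obtain ⟨hSk, hv⟩ := hmatch k le_rfl
  have hn₀k : m₀ + k ≤ n₀ := hmono.le_iff_le.1 (by omega)
  rcases Nat.eq_or_lt_of_le hn₀k with heq | hgt
  · -- the block boundaries are aligned with the two periods
    have hk0 : 0 < k := by
      rcases Nat.eq_zero_or_pos k with rfl | hk0
      · rw [← heq, add_zero] at hn₀; omega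
      · exact hk0
    refine ⟨m₀, k, hk0, fun j hj => ?_, ?_⟩
    · rw [Nat.cast_id, Nat.cast_id, heq]
      exact hv j hj
    · have h1 : S (m₀ + 2 * k - 1) < S (n₀ + k) := hmono (by omega)
      omega
  -- otherwise a block straddles the middle of the square
  have hS1 : a + p < S n₀ := lt_of_lt_of_le hk' (hmono.monotone (by omega))
  obtain ⟨m₁, rfl⟩ : ∃ m₁, m₀ = m₁ + 1 := by
    refine Nat.exists_eq_succ_of_ne_zero fun h1 => ?_
    rw [h1, h0] at hn₀
    omega
  obtain ⟨n₁, rfl⟩ : ∃ n₁, n₀ = n₁ + 1 := Nat.exists_eq_succ_of_ne_zero (by omega)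
  have hm₁ := hmin m₁ (by omega)
  have hn₁ : S n₁ < a + p := by
    by_contra! hcon
    have h1 := hadd n₁
    have h2 := hadd m₁
    have h3 : Reads x (S n₁ - p) (f (v n₁)) := by
      rw [← hsq.reads_add_iff (by omega) (by omega), Nat.sub_add_cancel (by omega)]
      exact hblock _
    have h4 := hf.suffix_code _ _ (h3.suffix_of_le (hblock m₁) (by omega) (by omega))
    rw [h4] at h1
    omega
  have hn : n₁ = m₁ + 1 + k := by
    have : n₁ < m₁ + 1 + (k + 1) := hmono.lt_iff_lt.1 (by omega)
    omega
  subst hn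
  have hb := hadd (m₁ + 1 + k)
  have hc := hadd (m₁ + 1 + k + 1 + k)
  have ha := hadd m₁
  have hSmk : S (m₁ + 1) ≤ S (m₁ + 1 + k) := hmono.monotone (by omega)
  obtain ⟨r, hr⟩ : ∃ r, a + p = S (m₁ + 1 + k) + r := ⟨a + p - S (m₁ + 1 + k), by omega⟩
  have hrlt : r < (f (v (m₁ + 1 + k))).length := by omega
  have hpre : (f (v (m₁ + 1 + k))).take r <+: f (v (m₁ + 1 + k + 1 + k)) := by
    have hl : ((f (v (m₁ + 1 + k))).take r).length = r := by rw [List.length_take]; omega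
    have h1 : Reads x (S (m₁ + 1 + k + 1 + k)) ((f (v (m₁ + 1 + k))).take r) := by
      rw [hSk]
      exact (hsq.reads_add_iff (by omega) (by omega)).2 ((hblock _).take r)
    rcases le_total r (f (v (m₁ + 1 + k + 1 + k))).length with hle | hle
    · exact h1.prefix_of_le (hblock _) (by omega)
    · have h2 := hf.prefix_code _ _
        (((hblock (m₁ + 1 + k + 1 + k)).prefix_of_le h1 (by omega)).trans (List.take_prefix _ _))
      rw [h2] at hle
      omega
  have hsuf : (f (v (m₁ + 1 + k))).drop r <:+ f (v m₁) := by
    have hl : ((f (v (m₁ + 1 + k))).drop r).length = (f (v (m₁ + 1 + k))).length - r :=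
      List.length_drop
    have h1 : Reads x (a + p) ((f (v (m₁ + 1 + k))).drop r) := by
      rw [hr]
      simpa using (hblock (m₁ + 1 + k)).drop (k := r) (by omega)
    rw [hsq.reads_add_iff le_rfl (by omega)] at h1
    exact h1.suffix_of_le (hblock m₁) (by omega) (by omega)
  rcases hf.splits _ _ _ r hrlt hpre hsuf with hab | ⟨hr0, hcb | ⟨ha0, hb1, hc0⟩⟩
  · refine ⟨m₁, k + 1, by omega, fun j hj => ?_, ?_⟩
    · rw [Nat.cast_id, Nat.cast_id]
      rcases j with _ | j
      · rw [add_zero, add_zero, hab]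
        congr 1
        omega
      · have h1 := hv j (by omega)
        have e1 : m₁ + (j + 1) = m₁ + 1 + j := by omega
        have e2 : m₁ + (k + 1) + (j + 1) = m₁ + 1 + k + 1 + j := by omega
        rw [e1, e2, h1]
    · have h1 : S (m₁ + 2 * (k + 1) - 1) < S (m₁ + 1 + k + 1 + k) := hmono (by omega)
      omega
  · refine ⟨m₁ + 1, k + 1, by omega, fun j hj => ?_, ?_⟩
    · rw [Nat.cast_id, Nat.cast_id]
      have e2 : m₁ + 1 + (k + 1) + j = m₁ + 1 + k + 1 + j := by omega
      rw [e2]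
      rcases Nat.lt_succ_iff_lt_or_eq.1 hj with hj | rfl
      · exact hv j hj
      · exact hcb.symm
    · have e : m₁ + 1 + 2 * (k + 1) - 1 = m₁ + 1 + k + 1 + k := by omega
      rw [e]
      omega
  · -- here `v` contains `0 u 1 u 0`; if `u` is empty, this is `010`, otherwise the neighbours of
    -- the middle letter form `212`
    have hone : ∀ m, v m = v (m + 1) → S (m + 1) < a + 2 * p →
        ∃ m q, 0 < q ∧ SquareAt v m q ∧ S (m + 2 * q - 1) < a + 2 * p := by
      intro m h1 h2
      refine ⟨m, 1, one_pos, fun j hj => ?_, h2⟩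
      obtain rfl : j = 0 := by omega
      simpa using h1
    rcases k with _ | k
    · have : Reads v m₁ [0, 1, 0] := ⟨ha0, hb1, hc0, trivial⟩
      exact absurd (mem_factorSet.2 ⟨m₁, this⟩) h010
    have hfirst := hv 0 (by omega)
    have hlast := hv k (by omega)
    rw [add_zero, add_zero] at hfirst
    have e : m₁ + 1 + (k + 1) = m₁ + 1 + k + 1 := by omega
    have e' : m₁ + 1 + (k + 1) + 1 + (k + 1) = m₁ + 1 + (k + 1) + 1 + k + 1 := by omega
    by_cases h1 : v (m₁ + 1) = 0
    · exact hone m₁ (by rw [ha0, h1]) (by omega)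
    by_cases h2 : v (m₁ + 1) = 1
    · exact hone (m₁ + 1 + (k + 1)) (by rw [hb1, ← hfirst, h2]) (by omega)
    by_cases h3 : v (m₁ + 1 + k) = 1
    · exact hone (m₁ + 1 + k) (by rw [h3, ← e, hb1]) (by rw [← e]; omega)
    by_cases h4 : v (m₁ + 1 + k) = 0
    · exact hone (m₁ + 1 + (k + 1) + 1 + k) (by rw [← hlast, h4, ← e', hc0])
        (by rw [← e']; omega)
    have : Reads v (m₁ + 1 + k) [2, 1, 2] := by
      refine ⟨by omega, by rw [← hb1, e], ?_, trivial⟩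
      rw [← e, ← hfirst]
      omega
    exact absurd (mem_factorSet.2 ⟨_, this⟩) h212

end Pullback

/-! ### The Hall–Thue word is square-free and avoids `010` and `212` -/

/-- The word `v` is square-free and avoids the factors `010` and `212`. -/
structure IsHallThue {ι : Type*} [AddMonoidWithOne ι] (v : ι → Fin 3) : Prop where
  squareFree : ContainsOnlySquares v ∅
  not_mem_010 : [0, 1, 0] ∉ factorSet v
  not_mem_212 : [2, 1, 2] ∉ factorSet v

/-- No prefix of `u` is a square, `010` or `212`. -/
def hallThueHead (u : List (Fin 3)) : Bool :=
  headSquaresIn [] u && !([0, 1, 0].isPrefixOf u || [2, 1, 2].isPrefixOf u)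

theorem hallThueHead_of_forall {u : List (Fin 3)}
    (h : ∀ x : List (Fin 3), x ≠ [] → ¬ x ++ x <:+: u) (h010 : ¬ [0, 1, 0] <:+: u)
    (h212 : ¬ [2, 1, 2] <:+: u) : hallThueHead u = true := by
  simp only [hallThueHead, Bool.and_eq_true, Bool.not_eq_true', ← Bool.not_eq_true]
  refine ⟨headSquaresIn_of_forall fun x hx hxu => absurd hxu (h x hx), fun h1 => ?_⟩
  rw [Bool.or_eq_true, List.isPrefixOf_iff_prefix, List.isPrefixOf_iff_prefix] at h1
  exact h1.elim (fun h1 => h010 h1.isInfix) fun h1 => h212 h1.isInfix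

namespace IsHallThue

variable {ι : Type*} [AddMonoidWithOne ι] {v : ι → Fin 3}

theorem not_squareAt (hv : IsHallThue v) {i : ι} {p : ℕ} (hp : 0 < p) : ¬ SquareAt v i p :=
  fun h => (hv.squareFree.mem_of_squareAt hp h).elim

theorem head_of_reads (hv : IsHallThue v) {i : ι} {u : List (Fin 3)} (hu : Reads v i u) :
    hallThueHead u = true :=
  hallThueHead_of_forall (fun x hx hxu => (hv.squareFree.forall_of_reads hu x hx hxu).elim)
    (fun h => hv.not_mem_010 (mem_factorSet.2 (hu.exists_of_infix h)))
    (fun h => hv.not_mem_212 (mem_factorSet.2 (hu.exists_of_infix h)))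

theorem head_reverse_of_reads (hv : IsHallThue v) {i : ι} {u : List (Fin 3)} (hu : Reads v i u) :
    hallThueHead u.reverse = true := by
  refine hallThueHead_of_forall (fun x hx hxu => ?_)
    (fun h => hv.not_mem_010 (mem_factorSet.2 (hu.exists_of_infix (List.reverse_infix.1 h))))
    (fun h => hv.not_mem_212 (mem_factorSet.2 (hu.exists_of_infix (List.reverse_infix.1 h))))
  refine (hv.squareFree.forall_of_reads hu x.reverse (by simpa using hx) ?_).elim
  rw [← List.reverse_append, ← List.reverse_infix, List.reverse_reverse]
  exact hxu

end IsHallThue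

/-- Block boundaries of an image under `hallThueMorphism`: the letter `0`, and the letter `1` not
followed by `2`. -/
def hallThueCut (u : List (Fin 3)) : Bool :=
  [[0], [1, 0], [1, 1]].any fun b => b.isPrefixOf u

set_option synthInstance.maxHeartbeats 100000 in
set_option synthInstance.maxSize 512 in
theorem isSynchronizing_hallThueMorphism : IsSynchronizing hallThueMorphism 2 3 hallThueCut where
  pos := by decide
  ne_nil := hallThueMorphism_ne_nil
  length_le := by decide
  prefix_code := by decide
  suffix_code := by decide
  splits := by decide +kernel
  cut_iff := by decide +kernel

/-- `b3` is its own image; apart from the first one, a block starts at least two places after the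
letter that it is the image of. -/
theorem exists_isImage_b3 :
    ∃ S : ℕ → ℕ, S 0 = 0 ∧ (∀ n, 0 < n → n + 2 ≤ S n) ∧ IsImage hallThueMorphism b3 b3 S := by
  have h := isImage_imageWord hallThueMorphism_ne_nil b3
  rw [imageWord_b3] at h
  refine ⟨_, rfl, fun n hn => ?_, h⟩
  induction n, hn using Nat.le_induction with
  | base => exact (h.add_length 0).ge
  | succ n _ ih =>
    have := h.strictMono hallThueMorphism_ne_nil (Nat.lt_add_one n)
    beta_reduce at this
    omega

/-- Words of length 6 without squares, `010` and `212`: the condition passes to the blocks of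
length 6 of their images under `hallThueMorphism`. -/
theorem hallThueHead_image (a b c d e f : Fin 3)
    (h : [a, b, c, d, e, f].tails.all hallThueHead = true) :
    ∀ j < (hallThueMorphism a).length,
      j + 6 ≤ (applyMorphism hallThueMorphism [a, b, c, d, e, f]).length ∧
      (((applyMorphism hallThueMorphism [a, b, c, d, e, f]).drop j).take 6).tails.all
        hallThueHead = true := by
  revert a b c d e f
  decide +kernel

theorem hallThueHead_window_b3 (m : ℕ) : (window b3 m 6).tails.all hallThueHead = true := by
  obtain ⟨S, h0, hS, h⟩ := exists_isImage_b3
  induction m using Nat.strong_induction_on with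
  | _ m ih =>
    rcases Nat.eq_zero_or_pos m with rfl | hm
    · decide +kernel
    · obtain ⟨n, j, rfl, hj⟩ := h.exists_block hallThueMorphism_ne_nil h0 m
      have hn : n < S n + j := by
        rcases Nat.eq_zero_or_pos n with rfl | hn
        · omega
        · have := hS n hn; omega
      have h1 := ih n hn
      have h2 := (h.reads (reads_window b3 n 6)).1
      simp only [window_one_add] at h1 h2
      simp only [window, List.range_zero, List.map_nil] at h1 h2
      obtain ⟨h3, h4⟩ := hallThueHead_image _ _ _ _ _ _ h1 j hj
      have h5 := window_eq_of_reads ((h2.drop (k := j) (by omega)).take 6)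
      rw [List.length_take, List.length_drop, min_eq_left (by omega), Nat.cast_id] at h5
      rw [h5, h4]

theorem hallThueHead_of_reads_b3 {m : ℕ} {u : List (Fin 3)} (hu : Reads b3 m u)
    (hl : u.length ≤ 6) : hallThueHead (window b3 m 6) = true ∧ u <+: window b3 m 6 := by
  refine ⟨?_, hu.prefix_of_le (reads_window _ _ _) (by simpa using hl)⟩
  have := hallThueHead_window_b3 m
  rw [List.all_eq_true] at this
  exact this _ (by simp)

theorem isHallThue_b3 : IsHallThue b3 := by
  have h010 : [0, 1, 0] ∉ factorSet b3 := fun h => by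
    obtain ⟨m, hm⟩ := mem_factorSet.1 h
    obtain ⟨h1, h2⟩ := hallThueHead_of_reads_b3 hm (by simp)
    rw [← List.isPrefixOf_iff_prefix] at h2
    simp [hallThueHead, h2] at h1
  have h212 : [2, 1, 2] ∉ factorSet b3 := fun h => by
    obtain ⟨m, hm⟩ := mem_factorSet.1 h
    obtain ⟨h1, h2⟩ := hallThueHead_of_reads_b3 hm (by simp)
    rw [← List.isPrefixOf_iff_prefix] at h2
    simp [hallThueHead, h2] at h1
  obtain ⟨S, h0, hS, h⟩ := exists_isImage_b3
  -- pulling a square back moves its last letter to the left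
  have key : ∀ N m q, 0 < q → m + 2 * q ≤ N → ¬ SquareAt b3 m q := by
    intro N
    induction N using Nat.strong_induction_on with
    | _ N ih =>
      intro m q hq hN hsq
      rcases Nat.lt_or_ge q 4 with hq4 | hq4
      · obtain ⟨h1, h2⟩ := hallThueHead_of_reads_b3 hsq.reads (by simp; omega)
        rw [hallThueHead, Bool.and_eq_true] at h1
        have h3 : window b3 m q ≠ [] := by
          rw [← List.length_pos_iff, length_window]
          exact hq
        exact List.not_mem_nil (mem_of_headSquaresIn h1.1 h3 h2)
      · obtain ⟨m', q', hq', hsq', hlt⟩ :=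
          isSynchronizing_hallThueMorphism.exists_squareAt h h0 h010 h212 (by omega) hsq
        have := hS (m' + 2 * q' - 1) (by omega)
        exact ih (m' + 2 * q') (by omega) m' q' hq' le_rfl hsq'
  refine ⟨fun u hu hsq => ?_, h010, h212⟩
  obtain ⟨m, hm⟩ := mem_factorSet.1 hsq
  exact key _ m u.length (List.length_pos_of_ne_nil hu) le_rfl (squareAt_of_reads hm)

/-! ### The squares of the image of the Hall–Thue word under `g5` -/

/-- `fiveSquares` as a list. -/
def fiveSquaresList : List (List (Fin 2)) :=
  [[0,0], [1,1], [0,0,0,0], [0,0,0,1,1,0,0,0,1,1], [1,0,0,0,0,1,0,0,0,0]]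

theorem fiveSquares_eq : fiveSquares = {x | x ∈ fiveSquaresList} := by
  ext x
  simp [fiveSquares, fiveSquaresList]

/-- The beginning of the images under `g5` of right-infinite words: `g5 0` and `g5 1` begin with
`000010`, and `g5 2` followed by another block begins with `00000110000`. -/
def g5Starts : List (List (Fin 2)) := [[0,0,0,0,1,0], [0,0,0,0,0,1,1,0,0,0,0]]

set_option synthInstance.maxHeartbeats 100000 in
set_option synthInstance.maxSize 512 in
theorem isSynchronizing_g5 :
    IsSynchronizing g5 11 25 fun u => g5Starts.any fun b => b.isPrefixOf u where
  pos := by decide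
  ne_nil := g5_ne_nil
  length_le := by decide
  prefix_code := by decide +kernel
  suffix_code := by decide +kernel
  splits := by decide +kernel
  cut_iff := by decide +kernel

/-- For a nonempty ternary word `u` whose image under `g5` is long enough, all squares of length at
most 68 in this image that start in the first block belong to `fiveSquares`. -/
def g5SmallSquares : List (Fin 3) → Bool
  | [] => false
  | c :: u => decide ((g5 c).length + 68 ≤ (applyMorphism g5 (c :: u)).length) &&
      (List.range (g5 c).length).all fun j =>
        headSquaresIn fiveSquaresList (((applyMorphism g5 (c :: u)).drop j).take 68)

theorem search_g5SmallSquares : search (List.finRange 3) hallThueHead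
    (fun u => g5SmallSquares u.reverse) 8 [] = true := by
  decide +kernel

theorem containsOnlySquares_imageWord_g5 {v : ℕ → Fin 3} (hv : IsHallThue v) :
    ContainsOnlySquares (imageWord g5 v) fiveSquares := by
  have h := isImage_imageWord g5_ne_nil v
  intro u hu hsq
  obtain ⟨a, ha⟩ := mem_factorSet.1 hsq
  have hpos := List.length_pos_of_ne_nil hu
  rcases Nat.lt_or_ge u.length 35 with hlt | hge
  · obtain ⟨m, j, rfl, hj⟩ := h.exists_block g5_ne_nil rfl a
    obtain ⟨t, ht, hs⟩ := exists_reads_of_search_right (fun c => List.mem_finRange c)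
      (fun i u hu => hv.head_reverse_of_reads hu) search_g5SmallSquares (i := m) (u := []) trivial
    rw [List.nil_append, List.reverse_reverse] at hs
    rcases t with _ | ⟨c, t⟩
    · cases hs
    simp only [g5SmallSquares, Bool.and_eq_true, decide_eq_true_eq, List.all_eq_true,
      List.mem_range] at hs
    obtain rfl : v m = c := ht.1
    have h1 := (h.reads ht).1
    rw [List.nil_append] at h1
    have h2 := ((h1.drop (k := j) (by omega)).take 68)
    rw [fiveSquares_eq]
    refine mem_of_headSquaresIn (hs.2 j hj) hu (ha.prefix_of_le h2 ?_)
    rw [List.length_take, List.length_drop, List.length_append]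
    omega
  · obtain ⟨m, q, hq, hsq, -⟩ := isSynchronizing_g5.exists_squareAt h rfl hv.not_mem_010
      hv.not_mem_212 (by omega) (squareAt_of_reads ha)
    exact (hv.not_squareAt hq hsq).elim

/-! ### Good bi-infinite binary words are images under `g5` -/

/-- The word `u` begins with a letter `1`, the end of a block, followed by the beginning of
another block. -/
def g5CutAtOne (u : List (Fin 2)) : Bool := g5Starts.any fun b => (1 :: b).isPrefixOf u

/-- In `u`, which begins one letter before a block boundary, a block of `g5` follows, and leads to
another block boundary. -/
def g5RightBlock (u : List (Fin 2)) : Bool :=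
  (List.finRange 3).any fun c => (g5 c).isPrefixOf u.tail && g5CutAtOne (u.drop (g5 c).length)

/-- In `u`, whose last `n` letters begin one letter before a block boundary, a block of `g5`
ends at this boundary, and begins at another block boundary. -/
def g5LeftBlock (n : ℕ) (u : List (Fin 2)) : Bool :=
  (List.finRange 3).any fun c => decide ((g5 c).length + n ≤ u.length) &&
    ((g5 c).isPrefixOf (u.drop (u.length - n + 1 - (g5 c).length)) &&
      g5CutAtOne (u.drop (u.length - n - (g5 c).length)))

/-- A word without bad squares that extends indefinitely to the left contains `10000`. -/
theorem search_10000 : search (List.finRange 2) (headSquaresIn fiveSquaresList)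
    (fun u => [1, 0, 0, 0, 0].isPrefixOf u) 20 [] = true := by
  decide +kernel

/-- Every right-infinite continuation of `10000` without bad squares reaches a block boundary. -/
theorem search_g5Starts : search (List.finRange 2)
    (headSquaresIn (fiveSquaresList.map List.reverse))
    (fun u => g5Starts.any fun b => (1 :: b).reverse.isPrefixOf u) 40 [0, 0, 0, 0, 1] = true := by
  decide +kernel

theorem search_g5RightBlock : ∀ b ∈ g5Starts, search (List.finRange 2)
    (headSquaresIn (fiveSquaresList.map List.reverse)) (fun u => g5RightBlock u.reverse) 40
    (1 :: b).reverse = true := by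
  decide +kernel

/-- The occurrence of a block boundary is extended first to the right, to at least 18 letters, and
then to the left: some words that can be extended to the left indefinitely, but not to the right,
have to be ruled out. -/
theorem search_g5LeftBlock : ∀ b ∈ g5Starts, search (List.finRange 2)
    (headSquaresIn (fiveSquaresList.map List.reverse))
    (fun u => decide (18 ≤ u.length) && search (List.finRange 2) (headSquaresIn fiveSquaresList)
      (g5LeftBlock u.length) 40 u.reverse) 40 (1 :: b).reverse = true := by
  decide +kernel

/-- A block boundary of `w`, as a preimage under `g5`, at position `i`. -/
def IsG5Cut (w : ℤ → Fin 2) (i : ℤ) : Prop := ∃ b ∈ g5Starts, Reads w (i - 1) (1 :: b)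

theorem isG5Cut_of_reads {w : ℤ → Fin 2} {i : ℤ} {u : List (Fin 2)} (hu : Reads w (i - 1) u)
    (h : g5CutAtOne u = true) : IsG5Cut w i := by
  simp only [g5CutAtOne, List.any_eq_true, List.isPrefixOf_iff_prefix] at h
  obtain ⟨b, hb, t, rfl⟩ := h
  exact ⟨b, hb, (reads_append.1 hu).1⟩

theorem reads_of_isPrefixOf {ι α : Type*} [AddMonoidWithOne ι] [DecidableEq α] {w : ι → α} {i : ι}
    {u t : List α} (hu : Reads w i u) (h : t.isPrefixOf u = true) : Reads w i t := by
  obtain ⟨s, rfl⟩ := List.isPrefixOf_iff_prefix.1 h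
  exact (reads_append.1 hu).1

section Good

variable {w : ℤ → Fin 2}

theorem exists_isG5Cut (hw : ContainsOnlySquares w {x | x ∈ fiveSquaresList}) :
    ∃ i, IsG5Cut w i := by
  obtain ⟨t, h1, h2⟩ := exists_reads_of_search_left (fun c => List.mem_finRange c)
    (fun i u hu => headSquaresIn_of_reads hw hu) search_10000 (i := 0) (u := []) trivial
  have h3 := reads_of_isPrefixOf h1 h2
  obtain ⟨s, h4, h5⟩ := exists_reads_of_search_right (fun c => List.mem_finRange c)
    (fun i u hu => headSquaresIn_reverse_of_reads hw hu) (u := [1, 0, 0, 0, 0])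
    search_g5Starts h3
  simp only [List.any_eq_true, List.isPrefixOf_iff_prefix] at h5
  obtain ⟨b, hb, h5⟩ := h5
  obtain ⟨j, hj⟩ := h4.exists_of_infix (List.reverse_prefix.1 h5).isInfix
  exact ⟨j + 1, b, hb, by simpa using hj⟩

theorem exists_g5_right (hw : ContainsOnlySquares w {x | x ∈ fiveSquaresList}) {i : ℤ}
    (hi : IsG5Cut w i) : ∃ c, Reads w i (g5 c) ∧ IsG5Cut w (i + (g5 c).length) := by
  obtain ⟨b, hb, hr⟩ := hi
  obtain ⟨t, h1, h2⟩ := exists_reads_of_search_right (fun c => List.mem_finRange c)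
    (fun i u hu => headSquaresIn_reverse_of_reads hw hu) (search_g5RightBlock b hb) hr
  rw [List.reverse_reverse] at h2
  simp only [g5RightBlock, List.any_eq_true, Bool.and_eq_true] at h2
  obtain ⟨c, -, h3, h4⟩ := h2
  have h5 : Reads w i (1 :: b ++ t).tail := by
    have := h1.drop (k := 1) (by simp)
    simpa using this
  refine ⟨c, reads_of_isPrefixOf h5 h3, isG5Cut_of_reads ?_ h4⟩
  have h6 := (List.isPrefixOf_iff_prefix.1 h3).length_le
  rw [List.length_tail] at h6
  have h7 := h1.drop (k := (g5 c).length) (by omega)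
  rwa [show i - 1 + ((g5 c).length : ℤ) = i + (g5 c).length - 1 by ring] at h7

theorem exists_g5_left (hw : ContainsOnlySquares w {x | x ∈ fiveSquaresList}) {i : ℤ}
    (hi : IsG5Cut w i) :
    ∃ c, Reads w (i - (g5 c).length) (g5 c) ∧ IsG5Cut w (i - (g5 c).length) := by
  obtain ⟨b, hb, hr⟩ := hi
  obtain ⟨t, h1, h2⟩ := exists_reads_of_search_right (fun c => List.mem_finRange c)
    (fun i u hu => headSquaresIn_reverse_of_reads hw hu) (search_g5LeftBlock b hb) hr
  rw [Bool.and_eq_true, List.reverse_reverse, List.length_reverse] at h2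
  generalize 1 :: b ++ t = base at h1 h2
  obtain ⟨s, h3, h4⟩ := exists_reads_of_search_left (fun c => List.mem_finRange c)
    (fun i u hu => headSquaresIn_of_reads hw hu) h2.2 (i := i - 1 + base.length)
    (by simpa using h1)
  simp only [g5LeftBlock, List.any_eq_true, Bool.and_eq_true, decide_eq_true_eq] at h4
  obtain ⟨c, -, h5, h6, h7⟩ := h4
  have hpos := List.length_pos_of_ne_nil (g5_ne_nil c)
  rw [List.length_append] at h3 h5 h6 h7
  refine ⟨c, reads_of_isPrefixOf ?_ h6, isG5Cut_of_reads ?_ h7⟩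
  · have h8 := h3.drop (k := s.length + base.length - base.length + 1 - (g5 c).length)
      (by rw [List.length_append]; omega)
    convert h8 using 1
    omega
  · have h8 := h3.drop (k := s.length + base.length - base.length - (g5 c).length)
      (by rw [List.length_append]; omega)
    convert h8 using 1
    omega

theorem isHallThue_of_forall_not_reads {v : ℤ → Fin 3} (hv : ContainsOnlySquares v ∅)
    (h010 : ∀ n, ¬ Reads v n [0, 1, 0]) (h02120 : ∀ n, ¬ Reads v n [0, 2, 1, 2, 0]) :
    IsHallThue v := by
  have hv' : ContainsOnlySquares v {x | x ∈ ([] : List (List (Fin 3)))} := by simpa using hv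
  refine ⟨hv, fun h => ?_, fun h => ?_⟩
  · obtain ⟨n, hn⟩ := mem_factorSet.1 h
    exact h010 n hn
  · obtain ⟨n, hn⟩ := mem_factorSet.1 h
    -- the neighbours of `212` in a square-free word are both `0`
    have h1 : Reads v (n - 1) [v (n - 1), 2, 1, 2, v (n + 3)] := by
      have h2 : Reads v n ([2, 1, 2] ++ [v (n + 3)]) := reads_append.2 ⟨hn, rfl, trivial⟩
      exact ⟨rfl, by simpa using h2⟩
    have key : ∀ a b : Fin 3, headSquaresIn [] [a, 2, 1, 2, b] = true →
        headSquaresIn [] [2, 1, 2, b] = true → headSquaresIn [] [2, b] = true →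
        a = 0 ∧ b = 0 := by decide
    obtain ⟨ha, hb⟩ := key _ _ (headSquaresIn_of_reads hv' h1)
      (headSquaresIn_of_reads hv' (h1.drop (k := 1) (by simp)))
      (headSquaresIn_of_reads hv' (h1.drop (k := 3) (by simp)))
    rw [ha, hb] at h1
    exact h02120 _ h1

theorem IsImage.square_mem_factorSet {ι β γ : Type*} [AddMonoidWithOne ι] {f : γ → List β}
    {v : ι → γ} {w : ι → β} {S : ι → ι} (h : IsImage f v w S) {u : List γ}
    (hu : u ++ u ∈ factorSet v) :
    applyMorphism f u ++ applyMorphism f u ∈ factorSet w := by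
  obtain ⟨n, hn⟩ := mem_factorSet.1 hu
  have := (h.reads hn).1
  rw [applyMorphism, List.flatMap_append] at this
  exact mem_factorSet.2 ⟨_, this⟩

/-- If `w` is good, then `v` is square-free, because squares among the five have period at most
5 and blocks of `g5` are longer. The images of `010` and `02120` contain forbidden squares, because
`g5 1` is the concatenation of a prefix and a suffix of `g5 0`. -/
theorem isHallThue_of_isImage_g5 (hw : ContainsOnlySquares w {x | x ∈ fiveSquaresList})
    {v : ℤ → Fin 3} {S : ℤ → ℤ} (h : IsImage g5 v w S) : IsHallThue v := by
  refine isHallThue_of_forall_not_reads (fun u hu hsq => ?_) (fun n hn => ?_) (fun n hn => ?_)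
  · have h1 := hw _ (applyMorphism_ne_nil g5_ne_nil hu) (h.square_mem_factorSet hsq)
    have h2 : ∀ x ∈ fiveSquaresList, x.length ≤ 10 := by decide
    have h3 := h2 _ h1
    obtain ⟨c, u, rfl⟩ := List.exists_cons_of_ne_nil hu
    have h4 : ∀ c, 7 ≤ (g5 c).length := by decide
    have := h4 c
    simp only [applyMorphism, List.flatMap_cons, List.length_append] at h3
    omega
  · have h1 := headSquaresIn_of_reads hw ((h.reads hn).1.drop (k := 19) (by decide))
    revert h1
    decide
  · have h1 := headSquaresIn_of_reads hw ((h.reads hn).1.drop (k := 19) (by decide))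
    revert h1
    decide

theorem exists_isImage_g5 (hw : ContainsOnlySquares w {x | x ∈ fiveSquaresList}) :
    ∃ v S, IsHallThue v ∧ IsImage g5 v w S := by
  obtain ⟨v, S, h⟩ := exists_isImage (exists_isG5Cut hw) (fun _ => exists_g5_right hw)
    fun _ => exists_g5_left hw
  exact ⟨v, S, isHallThue_of_isImage_g5 hw h, h⟩

end Good

/-! ### Desubstitution of bi-infinite words under the Hall–Thue morphism -/

theorem IsHallThue.exists_isImage {v : ℤ → Fin 3} (hv : IsHallThue v) :
    ∃ u S, IsHallThue u ∧ IsImage hallThueMorphism u v S := by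
  have hne : ∀ i, v i ≠ v (i + 1) := fun i hi => hv.not_squareAt (i := i) one_pos fun k hk => by
    obtain rfl : k = 0 := by omega
    simpa using hi
  have h010 : ∀ i, v i = 0 → v (i + 1) = 1 → v (i + 2) ≠ 0 := fun i h0 h1 h2 =>
    hv.not_mem_010 (mem_factorSet.2 ⟨i, by simp [Reads, add_assoc, h0, h1, h2]⟩)
  have h212 : ∀ i, v i = 2 → v (i + 1) = 1 → v (i + 2) ≠ 2 := fun i h0 h1 h2 =>
    hv.not_mem_212 (mem_factorSet.2 ⟨i, by simp [Reads, add_assoc, h0, h1, h2]⟩)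
  let B : ℤ → Prop := fun i => v i = 0 ∨ v i = 1 ∧ v (i + 1) ≠ 2
  have hB2 : ∀ i, v i = 2 → B (i + 1) := by
    intro i hi
    have h1 := hne i
    have h2 := h212 i hi
    rw [show i + 2 = i + 1 + 1 by ring] at h2
    change v (i + 1) = 0 ∨ v (i + 1) = 1 ∧ v (i + 1 + 1) ≠ 2
    by_cases h3 : v (i + 1) = 1
    · exact Or.inr ⟨h3, h2 h3⟩
    · left; omega
  obtain ⟨u, S, h⟩ := FewSquares.exists_isImage (f := hallThueMorphism) (w := v) (B := B)
    (by
      by_cases h0 : v 0 = 0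
      · exact ⟨0, Or.inl h0⟩
      by_cases h2 : v 0 = 2
      · exact ⟨_, hB2 0 h2⟩
      by_cases h3 : v (0 + 1) = 2
      · exact ⟨_, hB2 _ h3⟩
      · exact ⟨0, Or.inr ⟨by omega, h3⟩⟩)
    (by
      rintro i (h0 | ⟨h1, h2⟩)
      · have h3 := hne i
        by_cases h4 : v (i + 1) = 2
        · refine ⟨1, ⟨h0, h4, trivial⟩, ?_⟩
          have := hB2 _ h4
          rwa [add_assoc] at this
        · have h5 : v (i + 1) = 1 := by omega
          have h6 := hne (i + 1)
          have h7 := h010 i h0 h5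
          rw [show i + 2 = i + 1 + 1 by ring] at h7
          have h8 : v (i + 1 + 1) = 2 := by omega
          refine ⟨0, ⟨h0, h5, h8, trivial⟩, ?_⟩
          have := hB2 _ h8
          rwa [add_assoc, add_assoc] at this
      · refine ⟨2, ⟨h1, trivial⟩, Or.inl ?_⟩
        have h3 := hne i
        change v (i + 1) = 0
        omega)
    (by
      intro i hi
      have hne1 := hne (i - 1)
      have hne2 := hne (i - 2)
      have hne3 := hne (i - 3)
      have k0 := h010 (i - 1)
      have k2 := h212 (i - 3)
      rw [show i - 1 + 1 = i by ring] at hne1 k0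
      rw [show i - 1 + 2 = i + 1 by ring] at k0
      rw [show i - 2 + 1 = i - 1 by ring] at hne2
      rw [show i - 3 + 1 = i - 2 by ring] at hne3 k2
      rw [show i - 3 + 2 = i - 1 by ring] at k2
      have hne0 := hne i
      by_cases h2 : v (i - 1) = 2
      · by_cases h0 : v (i - 2) = 0
        · refine ⟨1, ⟨h0, ?_, trivial⟩, Or.inl h0⟩
          change v (i - 2 + 1) = 2
          rw [show i - 2 + 1 = i - 1 by ring, h2]
        · have h1 : v (i - 2) = 1 := by omega
          have h3 : v (i - 3) = 0 := by
            by_contra h4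
            exact k2 (by omega) h1 h2
          refine ⟨0, ⟨h3, ?_, ?_, trivial⟩, Or.inl h3⟩
          · change v (i - 3 + 1) = 1
            rw [show i - 3 + 1 = i - 2 by ring, h1]
          · change v (i - 3 + 1 + 1) = 2
            rw [show i - 3 + 1 + 1 = i - 1 by ring, h2]
      · have h1 : v (i - 1) = 1 := by
          by_contra h1
          rcases hi with h3 | ⟨h3, h4⟩
          · omega
          · exact k0 (by omega) h3 (by omega)
        refine ⟨2, ⟨h1, trivial⟩, Or.inr ⟨h1, ?_⟩⟩
        change v (i - 1 + 1) ≠ 2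
        rw [show i - 1 + 1 = i by ring]
        rcases hi with h3 | ⟨h3, h4⟩ <;> omega)
  refine ⟨u, S, ?_, h⟩
  have hv' : ContainsOnlySquares v {x | x ∈ ([] : List (List (Fin 3)))} := by
    simpa using hv.squareFree
  refine isHallThue_of_forall_not_reads (fun x hx hsq => ?_) (fun n hn => ?_) (fun n hn => ?_)
  · exact (hv.squareFree _ (applyMorphism_ne_nil hallThueMorphism_ne_nil hx)
      (h.square_mem_factorSet hsq)).elim
  · -- the image `01202012` contains `2020`
    have h1 := headSquaresIn_of_reads hv' ((h.reads hn).1.drop (k := 2) (by decide))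
    revert h1
    decide
  · -- the image `0121021012` contains `210210`
    have h1 := headSquaresIn_of_reads hv' ((h.reads hn).1.drop (k := 2) (by decide))
    revert h1
    decide

/-! ### Factor sets -/

/-- The morphism that sends `c` to `g5 (f ^ N c)`, where `f` is the Hall–Thue morphism. -/
def g5Iterate : ℕ → Fin 3 → List (Fin 2)
  | 0 => g5
  | N + 1 => fun c => applyMorphism (g5Iterate N) (hallThueMorphism c)

theorem g5Iterate_ne_nil (N : ℕ) (c : Fin 3) : g5Iterate N c ≠ [] := by
  induction N generalizing c with
  | zero => exact g5_ne_nil c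
  | succ N ih => exact applyMorphism_ne_nil ih (hallThueMorphism_ne_nil c)

theorem le_length_g5Iterate (N : ℕ) (c : Fin 3) : N ≤ (g5Iterate N c).length + 1 := by
  have key : N ≤ (g5Iterate N 0).length ∧ N ≤ (g5Iterate N 1).length ∧
      N ≤ (g5Iterate N 2).length + 1 := by
    induction N with
    | zero => simp
    | succ N ih =>
      have h1 := List.length_pos_of_ne_nil (g5Iterate_ne_nil N 1)
      have h2 := List.length_pos_of_ne_nil (g5Iterate_ne_nil N 2)
      have e0 : g5Iterate (N + 1) 0 =
        g5Iterate N 0 ++ (g5Iterate N 1 ++ (g5Iterate N 2 ++ [])) := rfl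
      have e1 : g5Iterate (N + 1) 1 = g5Iterate N 0 ++ (g5Iterate N 2 ++ []) := rfl
      have e2 : g5Iterate (N + 1) 2 = g5Iterate N 1 ++ [] := rfl
      simp only [e0, e1, e2, List.length_append, List.length_nil]
      omega
  obtain rfl | rfl | rfl : c = 0 ∨ c = 1 ∨ c = 2 := by omega
  · omega
  · omega
  · omega

theorem exists_isImage_g5Iterate {w : ℤ → Fin 2}
    (hw : ContainsOnlySquares w {x | x ∈ fiveSquaresList}) (N : ℕ) :
    ∃ v S, IsHallThue v ∧ IsImage (g5Iterate N) v w S := by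
  induction N with
  | zero => exact exists_isImage_g5 hw
  | succ N ih =>
    obtain ⟨v, S, hv, h⟩ := ih
    obtain ⟨u, T, hu, h'⟩ := hv.exists_isImage
    exact ⟨u, S ∘ T, hu, h.comp h'⟩

theorem exists_isImage_g5Iterate_b3 (N : ℕ) :
    ∃ S : ℕ → ℕ, S 0 = 0 ∧ IsImage (g5Iterate N) b3 (imageWord g5 b3) S := by
  induction N with
  | zero => exact ⟨_, rfl, isImage_imageWord g5_ne_nil b3⟩
  | succ N ih =>
    obtain ⟨S, h0, h⟩ := ih
    obtain ⟨T, h0', -, h'⟩ := exists_isImage_b3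
    exact ⟨S ∘ T, by rw [Function.comp_apply, h0', h0], h.comp h'⟩

theorem IsImage.exists_le_lt {β γ : Type*} {f : γ → List β} {v : ℤ → γ} {w : ℤ → β} {S : ℤ → ℤ}
    (h : IsImage f v w S) (hf : ∀ c, f c ≠ []) (i : ℤ) : ∃ m, S m ≤ i ∧ i < S (m + 1) := by
  have hmono : Monotone fun n => S n - n := monotone_int_of_le_succ fun n => by
    have := List.length_pos_of_ne_nil (hf (v n))
    have := (h n).2
    omega
  obtain ⟨m, hm, hmax⟩ := Int.exists_greatest_of_bdd (P := fun m => S m ≤ i)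
    ⟨max 0 (i - S 0), fun z hz => by
      rcases le_total z 0 with h1 | h1
      · omega
      · have : S 0 - 0 ≤ S z - z := hmono h1
        omega⟩
    ⟨min 0 (i - S 0), by
      have : S (min 0 (i - S 0)) - min 0 (i - S 0) ≤ S 0 - 0 := hmono (min_le_left _ _)
      omega⟩
  refine ⟨m, hm, not_le.1 fun h1 => ?_⟩
  have := hmax _ h1
  omega

theorem exists_b3_eq_of_ne : ∀ a b : Fin 3, a ≠ b → ∃ i < 6, b3 i = a ∧ b3 (i + 1) = b := by
  decide +kernel

theorem IsHallThue.exists_eq_zero {v : ℤ → Fin 3} (hv : IsHallThue v) : ∃ i, v i = 0 := by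
  have key : ∀ a b c d : Fin 3, hallThueHead [a, b, c, d] = true →
      hallThueHead [b, c, d] = true → hallThueHead [c, d] = true →
      a = 0 ∨ b = 0 ∨ c = 0 ∨ d = 0 := by decide
  have h : Reads v 0 [v 0, v 1, v 2, v 3] := by simp [Reads]
  rcases key _ _ _ _ (hv.head_of_reads h) (hv.head_of_reads h.2) (hv.head_of_reads h.2.2)
    with h | h | h | h
  all_goals exact ⟨_, h⟩

theorem factorSet_eq {w : ℤ → Fin 2} (hw : ContainsOnlySquares w {x | x ∈ fiveSquaresList}) :
    factorSet w = factorSet (imageWord g5 b3) := by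
  ext u
  constructor
  · intro hu
    obtain ⟨i, hi⟩ := mem_factorSet.1 hu
    -- blocks of length at least `u.length`, so that `u` is covered by two of them
    obtain ⟨v, S, hv, h⟩ := exists_isImage_g5Iterate hw (u.length + 1)
    obtain ⟨T, -, h'⟩ := exists_isImage_g5Iterate_b3 (u.length + 1)
    obtain ⟨m, hm, hm'⟩ := h.exists_le_lt (g5Iterate_ne_nil _) i
    have hne : v m ≠ v (m + 1) := fun he => hv.not_squareAt (i := m) one_pos fun k hk => by
      obtain rfl : k = 0 := by omega
      simpa using he
    obtain ⟨t, -, ht, ht'⟩ := exists_b3_eq_of_ne _ _ hne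
    have h1 := (h.reads (n := m) (u := [v m, v (m + 1)]) ⟨rfl, rfl, trivial⟩).1
    have h2 := (h'.reads (n := t) (u := [v m, v (m + 1)]) ⟨ht, ht', trivial⟩).1
    have h3 := (h m).2
    have h4 := le_length_g5Iterate (u.length + 1) (v (m + 1))
    obtain ⟨d, rfl⟩ : ∃ d : ℕ, i = S m + d := ⟨(i - S m).toNat, by omega⟩
    have hlen : (applyMorphism (g5Iterate (u.length + 1)) [v m, v (m + 1)]).length =
        (g5Iterate (u.length + 1) (v m)).length +
          (g5Iterate (u.length + 1) (v (m + 1))).length := by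
      simp [applyMorphism]
    have h5 := h1.drop (k := d) (by omega)
    have h6 := hi.prefix_of_le h5 (by rw [List.length_drop]; omega)
    exact mem_factorSet.2 (h2.exists_of_infix (h6.isInfix.trans (List.drop_suffix _ _).isInfix))
  · intro hu
    obtain ⟨i, hi⟩ := mem_factorSet.1 hu
    -- the prefix of `g5(b3)` up to the end of `u` is covered by the first block, that of `0`
    obtain ⟨v, S, hv, h⟩ := exists_isImage_g5Iterate hw (i + u.length + 1)
    obtain ⟨T, h0, h'⟩ := exists_isImage_g5Iterate_b3 (i + u.length + 1)
    obtain ⟨m, hm⟩ := hv.exists_eq_zero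
    have h1 := (h m).1
    have h2 := (h' 0).1
    rw [hm] at h1
    rw [h0, b3_zero] at h2
    have h3 := le_length_g5Iterate (i + u.length + 1) 0
    have h4 := h2.drop (k := i) (by omega)
    rw [Nat.cast_id, zero_add] at h4
    have h5 := hi.prefix_of_le h4 (by rw [List.length_drop]; omega)
    exact mem_factorSet.2 (h1.exists_of_infix (h5.isInfix.trans (List.drop_suffix _ _).isInfix))

end FewSquares

theorem mainTheorem2 :
    FewSquares.ContainsOnlySquares (FewSquares.imageWord FewSquares.g5 FewSquares.b3)
        FewSquares.fiveSquares ∧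
      ∀ w : ℤ → Fin 2, FewSquares.ContainsOnlySquares w FewSquares.fiveSquares →
        FewSquares.factorSet w =
          FewSquares.factorSet (FewSquares.imageWord FewSquares.g5 FewSquares.b3) := by
  refine ⟨FewSquares.containsOnlySquares_imageWord_g5 FewSquares.isHallThue_b3, fun w hw => ?_⟩
  rw [FewSquares.fiveSquares_eq] at hw
  exact FewSquares.factorSet_eq hw
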